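/- Throughout, $A$, $B$, $C$ are irreducible square matrices of size greater than $1$ with entries in $\{0,1\}$ satisfying condition (I) of Cuntz--Krieger. Let $X_A=\{(x_n)_{n\ge 1} : A(x_n,x_{n+1})=1 \text{ for all } n\}$ with the product topology, and let $\sigma_A$ be the shift on $X_A$. A continuous orbit map $h:(X_A,\sigma_A)\to(X_B,\sigma_B)$ is a local homeomorphism $h:X_A\to X_B$ for which there are continuous functions $k_1,l_1:X_A\to\mathbb{Z}_{\ge 0}$ with $\sigma_B^{k_1(x)}(h(\sigma_A(x)))=\sigma_B^{l_1(x)}(h(x))$ for all $x\in X_A$. For $f\in C(X_B,\mathbb{Z})$ put $$\Psi_h(f)(x)=\sum_{i=0}^{l_1(x)-1}f(\sigma_B^i(h(x)))-\sum_{j=0}^{k_1(x)-1}f(\sigma_B^j(h(\sigma_A(x)))),\qquad x\in X_A .$$ Let $\mathrm{cobdy}(\sigma_A)=\{\xi-\xi\circ\sigma_A : \xi\in C(X_A,\mathbb{Z})\}$, $H^A=C(X_A,\mathbb{Z})/\mathrm{cobdy}(\sigma_A)$, and let $H^A_+$ be the set of classes of nonnegative functions; $(H^A,H^A_+)$ is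 an ordered abelian group. Let $h:(X_A,\sigma_A)\to(X_B,\sigma_B)$ and $g:(X_B,\sigma_B)\to(X_C,\sigma_C)$ be continuous orbit maps. Then the homomorphism $\Psi_h:C(X_B,\mathbb{Z})\to C(X_A,\mathbb{Z})$ does not depend on the choice of $k_1,l_1$ (and likewise $\Psi_g$), and (i) $\Psi_h\circ\Psi_g=\Psi_{g\circ h}$. (ii) $\Psi_h(\mathrm{cobdy}(\sigma_B))\subset\mathrm{cobdy}(\sigma_A)$ and $\Psi_g(\mathrm{cobdy}(\sigma_C))\subset\mathrm{cobdy}(\sigma_B)$. (iii) The induced homomorphisms $\bar\Psi_h:H^B\to H^A$ and $\bar\Psi_g:H^C\to H^B$ satisfy $\bar\Psi_h(H^B_+)\subset H^A_+$ and $\bar\Psi_g(H^C_+)\subset H^B_+$, and $\bar\Psi_h\circ\bar\Psi_g=\bar\Psi_{g\circ h}$. Consequently $(X_A,\sigma_A)\mapsto(H^A,H^A_+)$, $h\mapsto\bar\Psi_h$ is a contravariant functor from the category of these shifts, with continuous orbit maps as morphisms, to the category of ordered abelian groups with positive homomorphisms. If $h$ is a homeomorphism such that $h$ and $h^{-1}$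 are both continuous orbit maps, then $\bar\Psi_h$ is an isomorphism of ordered groups with inverse $\bar\Psi_{h^{-1}}$. Hence the functor descends to the category whose objects are the continuous orbit equivalence classes $[(X_A,\sigma_A)]$ and whose morphisms are the continuous orbit maps between (fixed) representatives, and its value at $[(X_A,\sigma_A)]$ is isomorphic to $(H^A,H^A_+)$. -/

import Mathlib

open CategoryTheory

/-- Condition (I) of Cuntz and Krieger: every state is connected by an admissible path to a state
`j` at which there are two different first-return loops. The loop `j, w₁, …, wᵣ, j` is recorded by
its list `w` of interior states, all of which are different from `j`. -/
def ConditionI {N : ℕ} (M : Matrix (Fin N) (Fin N) ℤ) : Prop :=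
  ∀ i : Fin N, ∃ j : Fin N, Relation.ReflTransGen (fun a b => M a b = 1) i j ∧
    ∃ w w' : List (Fin N), w ≠ w' ∧ j ∉ w ∧ j ∉ w' ∧
      List.IsChain (fun a b => M a b = 1) (j :: (w ++ [j])) ∧
      List.IsChain (fun a b => M a b = 1) (j :: (w' ++ [j]))

/-- The matrices defining one-sided topological Markov shifts: irreducible `{0,1}`-matrices of
size `N > 1` with condition (I). -/
structure MarkovShift where
  N : ℕ
  one_lt : 1 < N
  mat : Matrix (Fin N) (Fin N) ℤ
  zero_or_one : ∀ i j, mat i j = 0 ∨ mat i j = 1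
  irreducible : mat.IsIrreducible
  conditionI : ConditionI mat

namespace MarkovShift

/-- The one-sided shift space `X_A`, with the topology induced by the product topology. -/
abbrev X (A : MarkovShift) : Type :=
  {x : ℕ → Fin A.N // ∀ n, A.mat (x n) (x (n + 1)) = 1}

/-- The shift `σ_A : X_A → X_A`. -/
def σ (A : MarkovShift) : C(A.X, A.X) where
  toFun x := ⟨fun n => x.1 (n + 1), fun n => x.2 (n + 1)⟩
  continuous_toFun := by
    refine Continuous.subtype_mk (continuous_pi fun n => ?_) _
    exact (continuous_apply (n + 1)).comp continuous_subtype_val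

lemma σ_iterate (A : MarkovShift) (n : ℕ) (x : A.X) (m : ℕ) :
    ((A.σ)^[n] x).1 m = x.1 (m + n) := by
  induction n generalizing m with
  | zero => rfl
  | succ n ih =>
    rw [Function.iterate_succ_apply']
    change ((A.σ)^[n] x).1 (m + 1) = _
    rw [ih, add_right_comm]; rfl

end MarkovShift

/-- `σ_B^{k(x)} (h (σ_A x)) = σ_B^{l(x)} (h x)` for all `x ∈ X_A`. -/
def OrbitEq {A B : MarkovShift} (h : A.X → B.X) (k l : C(A.X, ℕ)) : Prop :=
  ∀ x, (B.σ)^[k x] (h (A.σ x)) = (B.σ)^[l x] (h x)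

/-- Continuous orbit maps `(X_A, σ_A) → (X_B, σ_B)`, as a property of maps. -/
def IsContOrbitMap {A B : MarkovShift} (h : A.X → B.X) : Prop :=
  IsLocalHomeomorph h ∧ ∃ k l : C(A.X, ℕ), OrbitEq h k l

/-- Continuous orbit maps `h : (X_A, σ_A) → (X_B, σ_B)`. -/
@[ext]
structure ContOrbitMap (A B : MarkovShift) where
  toFun : A.X → B.X
  isContOrbitMap : IsContOrbitMap toFun

/-- Continuous orbit equivalence: there is a homeomorphism which is, together with its inverse,
a continuous orbit map. -/
def ContOrbitEquiv (A B : MarkovShift) : Prop :=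
  ∃ e : A.X ≃ₜ B.X, IsContOrbitMap e ∧ IsContOrbitMap e.symm

section Composition

variable {A B C : MarkovShift}

/-- `k^n(x) = ∑_{i<n} k(σ^i x)`. -/
def birkhoff (k : C(A.X, ℕ)) (n : ℕ) (x : A.X) : ℕ :=
  ∑ i ∈ Finset.range n, k ((A.σ)^[i] x)

lemma OrbitEq.iterate {h : A.X → B.X} {k l : C(A.X, ℕ)} (hkl : OrbitEq h k l) (n : ℕ) (x : A.X) :
    (B.σ)^[birkhoff k n x] (h ((A.σ)^[n] x)) = (B.σ)^[birkhoff l n x] (h x) := by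
  induction n with
  | zero => simp [birkhoff]
  | succ n ih =>
    have h1 : birkhoff k (n + 1) x = birkhoff k n x + k ((A.σ)^[n] x) :=
      Finset.sum_range_succ (fun i => k ((A.σ)^[i] x)) n
    have h2 : birkhoff l (n + 1) x = l ((A.σ)^[n] x) + birkhoff l n x := by
      rw [add_comm (l _)]; exact Finset.sum_range_succ (fun i => l ((A.σ)^[i] x)) n
    rw [h1, h2, Function.iterate_add_apply, Function.iterate_succ_apply', hkl,
      ← Function.iterate_add_apply, add_comm, Function.iterate_add_apply, ih,
      ← Function.iterate_add_apply]

lemma continuous_iterate_nat (l : C(A.X, ℕ))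
    {Y : Type*} [TopologicalSpace Y] (F : ℕ → A.X → Y) (hF : ∀ n, Continuous (F n)) :
    Continuous fun x => F (l x) x := by
  rw [continuous_iff_continuousAt]
  intro x
  have hx : ∀ᶠ y in nhds x, F (l y) y = F (l x) y := by
    have : ∀ᶠ y in nhds x, l y = l x :=
      l.continuous.continuousAt.eventually
        (p := fun m => m = l x) (IsOpen.mem_nhds (isOpen_discrete {l x}) rfl)
    filter_upwards [this] with y hy
    rw [hy]
  exact ((hF (l x)).continuousAt).congr (hx.mono fun _ hy => hy.symm)

lemma continuous_birkhoff (k : C(B.X, ℕ)) (n : ℕ) : Continuous (birkhoff k n) := by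
  unfold birkhoff
  exact continuous_finsetSum _ fun i _ => k.continuous.comp (B.σ.continuous.iterate i)

lemma IsContOrbitMap.id : IsContOrbitMap (id : A.X → A.X) :=
  ⟨(Homeomorph.refl A.X).isLocalHomeomorph, ContinuousMap.const _ 0, ContinuousMap.const _ 1,
    fun _ => rfl⟩

lemma IsContOrbitMap.comp {g : B.X → C.X} {h : A.X → B.X} (hg : IsContOrbitMap g)
    (hh : IsContOrbitMap h) : IsContOrbitMap (g ∘ h) := by
  obtain ⟨hg, k₂, l₂, h₂⟩ := hg
  obtain ⟨hh, k₁, l₁, h₁⟩ := hh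
  have c1 : Continuous h := hh.continuous
  have c2 : Continuous fun x => h (A.σ x) := c1.comp A.σ.continuous
  refine ⟨hg.comp hh,
    ⟨fun x => birkhoff k₂ (l₁ x) (h x) + birkhoff l₂ (k₁ x) (h (A.σ x)), ?_⟩,
    ⟨fun x => birkhoff l₂ (l₁ x) (h x) + birkhoff k₂ (k₁ x) (h (A.σ x)), ?_⟩, ?_⟩
  · exact (continuous_iterate_nat l₁ (fun n x => birkhoff k₂ n (h x))
        fun n => (continuous_birkhoff k₂ n).comp c1).add
      (continuous_iterate_nat k₁ (fun n x => birkhoff l₂ n (h (A.σ x)))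
        fun n => (continuous_birkhoff l₂ n).comp c2)
  · exact (continuous_iterate_nat l₁ (fun n x => birkhoff l₂ n (h x))
        fun n => (continuous_birkhoff l₂ n).comp c1).add
      (continuous_iterate_nat k₁ (fun n x => birkhoff k₂ n (h (A.σ x)))
        fun n => (continuous_birkhoff k₂ n).comp c2)
  · intro x
    have e1 := h₂.iterate (l₁ x) (h x)
    have e2 := h₂.iterate (k₁ x) (h (A.σ x))
    rw [h₁ x] at e2
    simp only [ContinuousMap.coe_mk, Function.comp_apply]
    rw [Function.iterate_add_apply, ← e2, ← Function.iterate_add_apply, add_comm,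
      Function.iterate_add_apply, e1, ← Function.iterate_add_apply, add_comm]

end Composition

namespace ContOrbitMap

variable {A B C : MarkovShift}

/-- The identity of `X_A` as a continuous orbit map. -/
def id (A : MarkovShift) : ContOrbitMap A A := ⟨fun x => x, IsContOrbitMap.id⟩

/-- The composition `g ∘ h` of continuous orbit maps. -/
def comp (g : ContOrbitMap B C) (h : ContOrbitMap A B) : ContOrbitMap A C :=
  ⟨g.toFun ∘ h.toFun, g.isContOrbitMap.comp h.isContOrbitMap⟩

lemma continuous (h : ContOrbitMap A B) : Continuous h.toFun := h.isContOrbitMap.1.continuous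

/-- Some functions `k`, `l` as in the definition of a continuous orbit map. -/
noncomputable def k (h : ContOrbitMap A B) : C(A.X, ℕ) := h.isContOrbitMap.2.choose

/-- The function `l` belonging to `h.k`. -/
noncomputable def l (h : ContOrbitMap A B) : C(A.X, ℕ) := h.isContOrbitMap.2.choose_spec.choose

lemma orbitEq (h : ContOrbitMap A B) : OrbitEq h.toFun h.k h.l :=
  h.isContOrbitMap.2.choose_spec.choose_spec

end ContOrbitMap

/-- The category with the one-sided topological Markov shifts as objects and the continuous orbit
maps as morphisms. -/
instance : Category MarkovShift where
  Hom := ContOrbitMap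
  id := ContOrbitMap.id
  comp h g := g.comp h

lemma contOrbitEquiv_equivalence : Equivalence ContOrbitEquiv where
  refl A := ⟨Homeomorph.refl _, IsContOrbitMap.id, IsContOrbitMap.id⟩
  symm := fun ⟨e, h, h'⟩ => ⟨e.symm, h', h⟩
  trans := fun ⟨e, h, h'⟩ ⟨e₂, g, g'⟩ => ⟨e.trans e₂, g.comp h, h'.comp g'⟩

/-- The setoid of continuous orbit equivalence. -/
def coeSetoid : Setoid MarkovShift := ⟨ContOrbitEquiv, contOrbitEquiv_equivalence⟩

/-- The continuous orbit equivalence classes `[(X_A, σ_A)]` of one-sided topological Markov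
shifts. -/
def COEClass : Type := Quotient coeSetoid

/-- A representative of a continuous orbit equivalence class. -/
noncomputable def COEClass.rep (c : COEClass) : MarkovShift := Quotient.out c

/-- The continuous orbit equivalence class of a shift. -/
def COEClass.mk (A : MarkovShift) : COEClass := Quotient.mk coeSetoid A

/-- The category of continuous orbit equivalence classes; a morphism between two classes is a
continuous orbit map between their representatives. -/
noncomputable instance : Category COEClass where
  Hom c d := ContOrbitMap c.rep d.rep
  id c := ContOrbitMap.id c.rep
  comp h g := ContOrbitMap.comp g h

/-- The homomorphism `ξ ↦ ξ - ξ ∘ σ_A` on `C(X_A, ℤ)`. -/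
def coboundary (A : MarkovShift) : C(A.X, ℤ) →+ C(A.X, ℤ) where
  toFun ξ := ξ - ξ.comp A.σ
  map_zero' := by ext; simp
  map_add' ξ η := by ext; simp; ring

/-- The group `cobdy(σ_A) = {ξ - ξ ∘ σ_A}` of coboundaries. -/
def cobdy (A : MarkovShift) : AddSubgroup C(A.X, ℤ) := (coboundary A).range

/-- The group `H^A = C(X_A, ℤ) / cobdy(σ_A)`. -/
abbrev H (A : MarkovShift) : Type := C(A.X, ℤ) ⧸ cobdy A

/-- The class `[f]` in `H^A`. -/
abbrev H.mk (A : MarkovShift) : C(A.X, ℤ) →+ H A := QuotientAddGroup.mk' (cobdy A)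

section Recurrence

variable (A : MarkovShift)

lemma MarkovShift.exists_cons (a : Fin A.N) (x : A.X) (h : A.mat a (x.1 0) = 1) :
    ∃ y : A.X, y.1 0 = a ∧ A.σ y = x := by
  refine ⟨⟨fun n => Nat.casesOn n a x.1, ?_⟩, rfl, rfl⟩
  intro n
  cases n with
  | zero => exact h
  | succ n => exact x.2 n

lemma MarkovShift.exists_path (a b : Fin A.N)
    (p : @Quiver.Path _ (Matrix.toQuiver A.mat) a b) (x : A.X) (hx : x.1 0 = b) :
    ∃ y : A.X, y.1 0 = a ∧
      (A.σ)^[@Quiver.Path.length _ (Matrix.toQuiver A.mat) a b p] y = x := by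
  let := Matrix.toQuiver A.mat
  induction p generalizing x with
  | nil => exact ⟨x, hx, rfl⟩
  | @cons c d p e ih =>
    have hcd : A.mat c (x.1 0) = 1 := by
      have := e.down
      rcases A.zero_or_one c d with h | h
      · omega
      · rw [hx]; exact h
    obtain ⟨y, hy, hyx⟩ := A.exists_cons c x hcd
    obtain ⟨z, hz, hzy⟩ := ih y hy
    refine ⟨z, hz, ?_⟩
    rw [Quiver.Path.length_cons, Function.iterate_succ_apply', hzy, hyx]

lemma MarkovShift.exists_prefix (m : ℕ) (x y : A.X) (h : y.1 0 = x.1 m) :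
    ∃ z : A.X, (∀ i ≤ m, z.1 i = x.1 i) ∧ (A.σ)^[m] z = y := by
  induction m generalizing y with
  | zero => exact ⟨y, fun i hi => by obtain rfl : i = 0 := by omega
                                     exact h, rfl⟩
  | succ m ih =>
    obtain ⟨y', h1, h2⟩ := A.exists_cons (x.1 m) y (by rw [h]; exact x.2 m)
    obtain ⟨z, hz, hzy⟩ := ih y' h1
    refine ⟨z, ?_, by rw [Function.iterate_succ_apply', hzy, h2]⟩
    intro i hi
    rcases Nat.lt_or_ge i (m + 1) with h' | h'
    · exact hz i (by omega)
    · obtain rfl : i = m + 1 := by omega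
      have := A.σ_iterate m z 1
      rw [hzy, add_comm] at this
      rw [← this, ← h, ← h2]
      rfl

/-- Every neighbourhood of a point of `X_A` contains a point that returns to it. -/
lemma MarkovShift.exists_return (x : A.X) (U : Set A.X) (hU : U ∈ nhds x) :
    ∃ y ∈ U, ∃ n, 0 < n ∧ (A.σ)^[n] y ∈ U := by
  obtain ⟨m, hm⟩ : ∃ m : ℕ, ∀ y : A.X, (∀ i ≤ m, y.1 i = x.1 i) → y ∈ U := by
    rw [nhds_subtype_eq_comap, Filter.mem_comap] at hU
    obtain ⟨V, hV, hVU⟩ := hU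
    rw [nhds_pi, Filter.mem_pi] at hV
    obtain ⟨I, hI, t, ht, htV⟩ := hV
    obtain ⟨m, hm⟩ := hI.bddAbove
    refine ⟨m, fun y hy => hVU (htV ?_)⟩
    intro i hi
    rw [hy i (hm hi)]
    exact mem_of_mem_nhds (ht i)
  obtain ⟨p, hp⟩ := A.irreducible.connected (x.1 m) (x.1 0)
  obtain ⟨y, hy, hyx⟩ := A.exists_path _ _ p x rfl
  obtain ⟨z, hz, hzy⟩ := A.exists_prefix m x y hy
  refine ⟨z, hm z hz, _, Nat.add_pos_left hp m, ?_⟩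
  rw [Function.iterate_add_apply, hzy, hyx]
  exact mem_of_mem_nhds hU

/-- A nonnegative coboundary vanishes. -/
lemma eq_zero_of_nonneg_coboundary (F ξ : C(A.X, ℤ)) (hF : 0 ≤ F) (h : coboundary A ξ = F) :
    F = 0 := by
  have hx : ∀ x, F x = ξ x - ξ (A.σ x) := fun x => by rw [← h]; rfl
  have hmono : ∀ (n : ℕ) x, ξ ((A.σ)^[n] x) ≤ ξ x := by
    intro n
    induction n with
    | zero => intro x; exact le_rfl
    | succ n ih =>
      intro x
      rw [Function.iterate_succ_apply]
      have h1 := ih (A.σ x)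
      have h2 := hx x
      have h3 : (0 : ℤ) ≤ F x := hF x
      linarith
  ext x
  have hx0 : (0 : ℤ) ≤ F x := hF x
  change F x = 0
  have e1 : ∀ᶠ y in nhds x, ξ y = ξ x :=
    ξ.continuous.continuousAt.eventually (p := fun m => m = ξ x)
      (IsOpen.mem_nhds (isOpen_discrete {ξ x}) rfl)
  have e2 : ∀ᶠ y in nhds x, ξ (A.σ y) = ξ (A.σ x) :=
    (ξ.comp A.σ).continuous.continuousAt.eventually (p := fun m => m = ξ (A.σ x))
      (IsOpen.mem_nhds (isOpen_discrete {ξ (A.σ x)}) rfl)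
  obtain ⟨y, ⟨hy1, hy2⟩, n, hn, hn1, -⟩ := A.exists_return x _ (e1.and e2)
  obtain ⟨n, rfl⟩ : ∃ k, n = k + 1 := ⟨n - 1, by omega⟩
  rw [Function.iterate_succ_apply] at hn1
  have := hmono n (A.σ y)
  have := hx x
  linarith

end Recurrence

/-- The positive cone `H^A_+`: the classes of nonnegative functions. That
`H^A_+ ∩ (-H^A_+) = 0` makes `(H^A, H^A_+)` an ordered abelian group. -/
def HPlus (A : MarkovShift) : AddGroupCone (H A) where
  carrier := {u | ∃ f : C(A.X, ℤ), 0 ≤ f ∧ H.mk A f = u}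
  zero_mem' := ⟨0, le_rfl, map_zero _⟩
  add_mem' := by
    rintro _ _ ⟨f, hf, rfl⟩ ⟨g, hg, rfl⟩
    exact ⟨f + g, fun x => add_nonneg (hf x) (hg x), map_add _ _ _⟩
  eq_zero_of_mem_of_neg_mem' := by
    rintro _ ⟨f, hf, rfl⟩ ⟨g, hg, hgf⟩
    have h0 : H.mk A (f + g) = 0 := by rw [map_add, hgf, add_neg_cancel]
    obtain ⟨ξ, hξ⟩ : f + g ∈ cobdy A := (QuotientAddGroup.eq_zero_iff _).1 h0
    have hz := eq_zero_of_nonneg_coboundary A (f + g) ξ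
      (fun x => add_nonneg (hf x) (hg x)) hξ
    have : f = 0 := by
      ext x
      have h1 : f x + g x = 0 := DFunLike.congr_fun hz x
      have h2 : (0 : ℤ) ≤ f x := hf x
      have h3 : (0 : ℤ) ≤ g x := hg x
      change f x = 0
      linarith
    rw [this, map_zero]

/-- Ordered abelian groups `(G, G_+)`, given by their cones of nonnegative elements. -/
structure OrdAb where
  carrier : Type
  [group : AddCommGroup carrier]
  posCone : AddGroupCone carrier

attribute [instance] OrdAb.group

/-- Homomorphisms of ordered abelian groups: homomorphisms preserving the positive cones. -/
@[ext]
structure OrdAb.Hom (G K : OrdAb) where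
  toHom : G.carrier →+ K.carrier
  map_pos : ∀ u ∈ G.posCone, toHom u ∈ K.posCone

/-- The category `𝒜₊` of ordered abelian groups. -/
instance : Category OrdAb where
  Hom := OrdAb.Hom
  id G := ⟨AddMonoidHom.id _, fun _ h => h⟩
  comp φ ψ := ⟨ψ.toHom.comp φ.toHom, fun _ h => ψ.map_pos _ (φ.map_pos _ h)⟩

/-- The ordered cohomology group `(H^A, H^A_+)`. -/
def orderedH (A : MarkovShift) : OrdAb := ⟨H A, HPlus A⟩

section Psi

variable {A B : MarkovShift}

/-- The cocycle sum
`∑_{i < l(x)} f(σ_B^i(h(x))) - ∑_{j < k(x)} f(σ_B^j(h(σ_A(x))))`. -/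
def cocycleSum (h : A.X → B.X) (k l : C(A.X, ℕ)) (f : C(B.X, ℤ)) (x : A.X) : ℤ :=
  ∑ i ∈ Finset.range (l x), f ((B.σ)^[i] (h x)) -
    ∑ j ∈ Finset.range (k x), f ((B.σ)^[j] (h (A.σ x)))

lemma continuous_cocycleSum (h : A.X → B.X) (hh : Continuous h) (k l : C(A.X, ℕ))
    (f : C(B.X, ℤ)) : Continuous (cocycleSum h k l f) := by
  unfold cocycleSum
  refine Continuous.sub ?_ ?_
  · exact continuous_iterate_nat l
      (fun n x => ∑ i ∈ Finset.range n, f ((B.σ)^[i] (h x))) fun n =>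
      continuous_finsetSum _ fun i _ =>
        f.continuous.comp ((B.σ.continuous.iterate i).comp hh)
  · exact continuous_iterate_nat k
      (fun n x => ∑ i ∈ Finset.range n, f ((B.σ)^[i] (h (A.σ x)))) fun n =>
      continuous_finsetSum _ fun i _ =>
        f.continuous.comp ((B.σ.continuous.iterate i).comp (hh.comp A.σ.continuous))

/-- The homomorphism `Ψ_h : C(X_B, ℤ) → C(X_A, ℤ)`. -/
noncomputable def Psi (h : ContOrbitMap A B) : C(B.X, ℤ) →+ C(A.X, ℤ) where
  toFun f := ⟨cocycleSum h.toFun h.k h.l f, continuous_cocycleSum _ h.continuous _ _ _⟩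
  map_zero' := by ext; simp [cocycleSum]
  map_add' f g := by ext; simp [cocycleSum, Finset.sum_add_distrib]; ring

lemma Psi_coboundary (h : ContOrbitMap A B) (f : C(B.X, ℤ)) :
    Psi h (coboundary B f) = coboundary A (f.comp ⟨h.toFun, h.continuous⟩) := by
  have key : ∀ (n : ℕ) (y : B.X), ∑ i ∈ Finset.range n, (coboundary B f) ((B.σ)^[i] y)
      = f y - f ((B.σ)^[n] y) := by
    intro n y
    refine Eq.trans ?_ (Finset.sum_range_sub' (fun i => f ((B.σ)^[i] y)) n)
    refine Finset.sum_congr rfl fun i _ => ?_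
    rw [Function.iterate_succ_apply']
    rfl
  ext x
  change cocycleSum h.toFun h.k h.l (coboundary B f) x = f (h.toFun x) - f (h.toFun (A.σ x))
  unfold cocycleSum
  rw [key, key, h.orbitEq x]
  ring

lemma cobdy_le_comap_Psi (h : ContOrbitMap A B) : cobdy B ≤ (cobdy A).comap (Psi h) := by
  rintro _ ⟨f, rfl⟩
  exact ⟨_, (Psi_coboundary h f).symm⟩

/-- The homomorphism `Ψ̄_h : H^B → H^A`, `[f] ↦ [Ψ_h f]`. -/
noncomputable def PsiBar (h : ContOrbitMap A B) : H B →+ H A :=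
  QuotientAddGroup.map (cobdy B) (cobdy A) (Psi h) (cobdy_le_comap_Psi h)

end Psi

/-- Positivity of all the homomorphisms `Ψ̄_h`. -/
def PsiBarPositive : Prop :=
  ∀ ⦃A B : MarkovShift⦄ (h : ContOrbitMap A B), ∀ u ∈ HPlus B, PsiBar h u ∈ HPlus A

/-- `Ψ̄_h` as a homomorphism of ordered abelian groups `(H^B, H^B_+) → (H^A, H^A_+)`. -/
noncomputable def psiHom (hpos : PsiBarPositive) {A B : MarkovShift} (h : ContOrbitMap A B) :
    orderedH B ⟶ orderedH A :=
  OrdAb.Hom.mk (G := orderedH B) (K := orderedH A) (PsiBar h) (hpos h)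

/-- The correspondence `(X_A, σ_A) ↦ (H^A, H^A_+)`, `h ↦ Ψ̄_h`, without functor laws. -/
noncomputable def psiCorrespondence (hpos : PsiBarPositive) : MarkovShiftᵒᵖ ⥤q OrdAb where
  obj A := orderedH A.unop
  map h := psiHom hpos h.unop

/-- The correspondence `[(X_A, σ_A)] ↦ (H^A, H^A_+)`, `h ↦ Ψ̄_h` on continuous orbit equivalence
classes, without functor laws. -/
noncomputable def psiClassCorrespondence (hpos : PsiBarPositive) : COEClassᵒᵖ ⥤q OrdAb where
  obj c := orderedH c.unop.rep
  map h := psiHom hpos h.unop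

/-! If `T^[a] u = T^[b] v`, then the difference of the Birkhoff sums `S_b f v - S_a f u` depends on
`a` and `b` only through the lag `b - a`. By condition (I) different powers of the shift differ
somewhere in every nonempty open set, so the lag `l₁ - k₁` of a continuous orbit map `h` is
determined by `h`; hence `Ψ_h` is well defined, and `Ψ_h ∘ Ψ_g = Ψ_{g ∘ h}` amounts to concatenating
pairs of orbits that meet.

For positivity let `σⁿ x = x`. The `n`-th Birkhoff sum of `Ψ_h f` at `x` is a sum of `L - K` values
of `f`, where `L - K` is the lag of `h` over the whole period. It is positive: otherwise
`h ∘ σⁿ ∘ h⁻¹`, with a local inverse of `h`, would map small cylinders around `h x` into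
themselves, although `x` repels all other points under `σⁿ` and is not isolated. So `f ≥ 0` makes
all periodic sums of `Ψ_h f` nonnegative. Closing orbit segments up to periodic orbits then bounds
all Birkhoff sums of `F = Ψ_h f` from below, and `ξ x = inf {S_n F y | σⁿ y = x}` is a continuous
function with `F + ξ - ξ ∘ σ ≥ 0`. -/

section MeetingOrbits

variable {X : Type*} {T : X → X}

lemma iterate_add_eq_of_iterate_eq {u v w : X} {a b c d : ℕ} (huw : T^[a] u = T^[b] w)
    (hvw : T^[c] v = T^[d] w) : T^[a + d] u = T^[b + c] v := by
  rw [add_comm a, Function.iterate_add_apply, huw, Function.iterate_add_apply, hvw,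
    ← Function.iterate_add_apply, ← Function.iterate_add_apply, add_comm]

variable {G : Type*} [AddCommGroup G] {f : X → G}

lemma birkhoffSum_sub_eq_of_lag_eq {u v : X} {a b a' b' : ℕ} (h : T^[a] u = T^[b] v)
    (h' : T^[a'] u = T^[b'] v) (hlag : b + a' = b' + a) :
    birkhoffSum T f b v - birkhoffSum T f a u =
      birkhoffSum T f b' v - birkhoffSum T f a' u := by
  wlog haa : a ≤ a' generalizing a b a' b'
  · exact (this h' h hlag.symm (by omega)).symm
  obtain ⟨d, rfl⟩ := Nat.exists_eq_add_of_le haa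
  obtain rfl : b' = b + d := by omega
  rw [birkhoffSum_add, birkhoffSum_add, h, add_sub_add_right_eq_sub]

lemma birkhoffSum_sub_sub_of_iterate_eq {u v w : X} {a b c d : ℕ} (huw : T^[a] u = T^[b] w)
    (hvw : T^[c] v = T^[d] w) :
    (birkhoffSum T f a u - birkhoffSum T f b w) - (birkhoffSum T f c v - birkhoffSum T f d w) =
      birkhoffSum T f (a + d) u - birkhoffSum T f (b + c) v := by
  have hw : birkhoffSum T f b w + birkhoffSum T f d (T^[b] w) =
      birkhoffSum T f d w + birkhoffSum T f b (T^[d] w) := by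
    rw [← birkhoffSum_add, ← birkhoffSum_add, add_comm]
  rw [birkhoffSum_add, add_comm b c, birkhoffSum_add, huw, hvw,
    eq_sub_of_add_eq' hw]
  abel

end MeetingOrbits

section Lag

open Filter Topology

/-- Essential freeness of a map `T`, expressing that an orbit relation `T^[p] y = T^[q] y` on an
open set forces `p = q`: any two different iterates of `T` differ at points arbitrarily close to
every given point. -/
def IsEssentiallyFree {Y : Type*} [TopologicalSpace Y] (T : Y → Y) : Prop :=
  ∀ ⦃p q : ℕ⦄, p ≠ q → ∀ y, ∃ᶠ z in 𝓝 y, T^[p] z ≠ T^[q] z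

variable {X Y : Type*} [TopologicalSpace X] [TopologicalSpace Y]

lemma IsEssentiallyFree.lag_eq {T : Y → Y} (hT : IsEssentiallyFree T) {h h' : X → Y}
    (hh : IsOpenMap h) {x : X} {a b a' b' : ℕ} (hab : ∀ᶠ y in 𝓝 x, T^[a] (h' y) = T^[b] (h y))
    (hab' : ∀ᶠ y in 𝓝 x, T^[a'] (h' y) = T^[b'] (h y)) : b + a' = b' + a := by
  by_contra hne
  refine (hT hne (h x)).filter_mono (hh.nhds_le x) (eventually_map.2 ?_)
  filter_upwards [hab, hab'] with y hy hy'
  rw [not_not, add_comm b, Function.iterate_add_apply, ← hy, add_comm b',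
    Function.iterate_add_apply, ← hy', ← Function.iterate_add_apply,
    ← Function.iterate_add_apply, add_comm]

/-- Stability of a fixed point transfers along a local homeomorphism. -/
lemma exists_nhds_mapsTo_of_isLocalHomeomorph {h : X → Y} (hh : IsLocalHomeomorph h) {φ : X → X}
    {x : X} (hφ : ContinuousAt φ x) (hx : φ x = x) {ι : Sort*} {p : ι → Prop} {V : ι → Set Y}
    (hV : (𝓝 (h x)).HasBasis p V)
    (hφV : ∀ᶠ y in 𝓝 x, ∀ i, p i → h y ∈ V i → h (φ y) ∈ V i) {U : Set X} (hU : U ∈ 𝓝 x) :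
    ∃ W ∈ 𝓝 x, W ⊆ U ∧ Set.MapsTo φ W W := by
  obtain ⟨D, hD, hxD, hinj⟩ := hh.isLocallyInjective x
  have hφD : ∀ᶠ y in 𝓝 x, φ y ∈ D :=
    hφ.eventually_mem (by rw [hx]; exact hD.mem_nhds hxD)
  obtain ⟨E, hE, hED⟩ := (((eventually_mem_set.2 hU).and (hD.eventually_mem hxD)).and
    (hφD.and hφV)).exists_mem
  obtain ⟨i, hi, hVE⟩ := hV.mem_iff.1 (hh.isOpenMap.image_mem_nhds hE)
  refine ⟨E ∩ h ⁻¹' V i, inter_mem hE (hh.continuous.continuousAt (hV.mem_of_mem hi)),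
    fun y hy => (hED y hy.1).1.1, ?_⟩
  rintro y ⟨hyE, hyV⟩
  obtain ⟨-, hφyD, hφy⟩ := hED y hyE
  have hφyV : h (φ y) ∈ V i := hφy i hi hyV
  obtain ⟨z, hz, hzy⟩ := hVE hφyV
  have : z = φ y := hinj (hED z hz).1.2 hφyD hzy
  exact ⟨this ▸ hz, hφyV⟩

end Lag

namespace MarkovShift

open Filter Topology Function

variable (A : MarkovShift)

section Cylinders

/-- The cylinder of length `m` around `x`: the points whose first `m` coordinates
`x 0, …, x (m - 1)` are those of `x`. -/
def cylinder (x : A.X) (m : ℕ) : Set A.X := (↑) ⁻¹' PiNat.cylinder x.1 m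

variable {A}

lemma cylinder_anti (x : A.X) {m n : ℕ} (hmn : m ≤ n) : A.cylinder x n ⊆ A.cylinder x m :=
  Set.preimage_mono (PiNat.cylinder_anti x.1 hmn)

lemma mem_cylinder_comm {x y : A.X} {m : ℕ} : y ∈ A.cylinder x m ↔ x ∈ A.cylinder y m :=
  PiNat.mem_cylinder_comm x.1 y.1 m

lemma eq_of_forall_mem_cylinder {x y : A.X} (h : ∀ m, y ∈ A.cylinder x m) : y = x :=
  Subtype.ext (funext fun n => h (n + 1) n n.lt_succ_self)

lemma mem_cylinder_add_iff {x y : A.X} {m n : ℕ} :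
    y ∈ A.cylinder x (m + n) ↔
      y ∈ A.cylinder x m ∧ (A.σ)^[m] y ∈ A.cylinder ((A.σ)^[m] x) n := by
  constructor
  · refine fun h => ⟨cylinder_anti x (m.le_add_right n) h, fun i hi => ?_⟩
    rw [σ_iterate, σ_iterate]
    exact h _ (by omega)
  · rintro ⟨hm, hn⟩ i hi
    rcases lt_or_ge i m with him | him
    · exact hm i him
    · obtain ⟨j, rfl⟩ := Nat.exists_eq_add_of_le' him
      rw [← σ_iterate, ← σ_iterate]
      exact hn j (by omega)

lemma mem_cylinder_of_iterate_eq {x y z : A.X} {p q d : ℕ} (hyz : (A.σ)^[p] y = (A.σ)^[q] z)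
    (hx : (A.σ)^[p] x = (A.σ)^[q] x) (hy : y ∈ A.cylinder x p) (hz : z ∈ A.cylinder x (q + d)) :
    y ∈ A.cylinder x (p + d) := by
  rw [mem_cylinder_add_iff, hyz, hx]
  exact ⟨hy, (mem_cylinder_add_iff.1 hz).2⟩

lemma eq_of_forall_iterate_mem_cylinder {x y : A.X} {n : ℕ} (hn : 0 < n)
    (hx : IsPeriodicPt A.σ n x) (hy : ∀ r, ((A.σ)^[n])^[r] y ∈ A.cylinder x n) : y = x := by
  have key : ∀ r, y ∈ A.cylinder x (n * r) := by
    intro r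
    induction r with
    | zero => exact fun i hi => absurd hi (by simp)
    | succ r ih =>
      rw [Nat.mul_succ, mem_cylinder_add_iff, (hx.mul_const r).eq, iterate_mul]
      exact ⟨ih, hy r⟩
  exact eq_of_forall_mem_cylinder fun m => cylinder_anti x (Nat.le_mul_of_pos_left m hn) (key m)

variable (A)

lemma hasBasis_nhds_cylinder (x : A.X) : (𝓝 x).HasBasis (fun _ => True) (A.cylinder x) := by
  refine ⟨fun U => ⟨fun hU => ?_, ?_⟩⟩
  · rw [nhds_subtype_eq_comap, mem_comap] at hU
    obtain ⟨V, hV, hVU⟩ := hU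
    obtain ⟨_, ⟨y, m, rfl⟩, hxy, hyV⟩ :=
      (PiNat.isTopologicalBasis_cylinders fun _ => Fin A.N).mem_nhds_iff.1 hV
    refine ⟨m, trivial, fun z hz => hVU (hyV ?_)⟩
    rwa [← PiNat.mem_cylinder_iff_eq.1 hxy]
  · rintro ⟨m, -, hm⟩
    exact mem_of_superset ((PiNat.isOpen_cylinder _ x.1 m).preimage continuous_subtype_val
      |>.mem_nhds (PiNat.self_mem_cylinder x.1 m)) hm

lemma cylinder_mem_nhds (x : A.X) (m : ℕ) : A.cylinder x m ∈ 𝓝 x :=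
  (A.hasBasis_nhds_cylinder x).mem_of_mem trivial

lemma exists_mem_cylinder_iterate_eq {x y : A.X} {m : ℕ} (h : y.1 0 = x.1 m) :
    ∃ z ∈ A.cylinder x m, (A.σ)^[m] z = y := by
  obtain ⟨z, hz, hzy⟩ := A.exists_prefix m x y h
  exact ⟨z, fun i hi => hz i hi.le, hzy⟩

end Cylinders

section ConditionI

lemma exists_mat_eq_one (a : Fin A.N) : ∃ b, A.mat a b = 1 := by
  have : Nontrivial (Fin A.N) := Fin.nontrivial_iff_two_le.2 A.one_lt
  obtain ⟨b, hb⟩ := A.irreducible.exists_pos a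
  exact ⟨b, (A.zero_or_one a b).resolve_left hb.ne'⟩

lemma exists_apply_zero_eq (a : Fin A.N) : ∃ x : A.X, x.1 0 = a := by
  choose next hnext using A.exists_mat_eq_one
  refine ⟨⟨fun n => next^[n] a, fun n => ?_⟩, rfl⟩
  change A.mat (next^[n] a) (next^[n + 1] a) = 1
  rw [iterate_succ_apply']
  exact hnext _

variable {A}

lemma exists_forall_apply_eq_getElem {l : List (Fin A.N)} (hl : l ≠ [])
    (hchain : l.IsChain fun a b => A.mat a b = 1) :
    ∃ x : A.X, ∀ i (hi : i < l.length), x.1 i = l[i] := by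
  induction l with
  | nil => exact absurd rfl hl
  | cons a l ih =>
    cases l with
    | nil =>
      obtain ⟨x, hx⟩ := A.exists_apply_zero_eq a
      exact ⟨x, fun i hi => by obtain rfl : i = 0 := by simpa using hi
                               exact hx⟩
    | cons b l =>
      rw [List.isChain_cons_cons] at hchain
      obtain ⟨y, hy⟩ := ih (List.cons_ne_nil b l) hchain.2
      obtain ⟨x, hx, rfl⟩ := A.exists_cons a y (by rw [hy 0 (by simp)]; exact hchain.1)
      refine ⟨x, fun i hi => ?_⟩
      cases i with
      | zero => exact hx
      | succ i => exact hy i (by simpa using hi)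

lemma exists_ne_of_firstReturn_ne {j : Fin A.N} {w w' : List (Fin A.N)} (hne : w ≠ w')
    (hj : j ∉ w) (hj' : j ∉ w')
    (hw : List.IsChain (fun a b => A.mat a b = 1) (j :: (w ++ [j])))
    (hw' : List.IsChain (fun a b => A.mat a b = 1) (j :: (w' ++ [j]))) :
    ∃ x y : A.X, x ≠ y ∧ x.1 0 = j ∧ y.1 0 = j := by
  wlog hlen : w.length ≤ w'.length generalizing w w'
  · exact this hne.symm hj' hj hw' hw (not_le.1 hlen).le
  obtain ⟨x, hx⟩ := exists_forall_apply_eq_getElem (List.cons_ne_nil _ _) hw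
  obtain ⟨y, hy⟩ := exists_forall_apply_eq_getElem (List.cons_ne_nil _ _) hw'
  refine ⟨x, y, ?_, hx 0 (by simp), hy 0 (by simp)⟩
  rintro rfl
  have hxw : ∀ i (hi : i < w.length), x.1 (i + 1) = w[i] := fun i hi => by
    rw [hx (i + 1) (by simp; omega), List.getElem_cons_succ, List.getElem_append_left hi]
  have hxw' : ∀ i (hi : i < w'.length), x.1 (i + 1) = w'[i] := fun i hi => by
    rw [hy (i + 1) (by simp; omega), List.getElem_cons_succ, List.getElem_append_left hi]
  rcases hlen.lt_or_eq with hlt | heq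
  · have hxj : x.1 (w.length + 1) = j := by simpa using hx (w.length + 1) (by simp)
    exact hj' (by rw [← hxj, hxw' _ hlt]; exact List.getElem_mem _)
  · exact hne (List.ext_getElem heq fun i hi hi' => by rw [← hxw i hi, ← hxw' i hi'])

variable (A)

lemma exists_ne_apply_zero_eq (a : Fin A.N) :
    ∃ x y : A.X, x ≠ y ∧ x.1 0 = a ∧ y.1 0 = a := by
  obtain ⟨j, hpath, w, w', hne, hj, hj', hw, hw'⟩ := A.conditionI a
  induction hpath using Relation.ReflTransGen.head_induction_on with
  | refl => exact exists_ne_of_firstReturn_ne hne hj hj' hw hw'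
  | head hab _ ih =>
    obtain ⟨x, y, hxy, hx, hy⟩ := ih
    obtain ⟨x', hx', rfl⟩ := A.exists_cons _ x (by rw [hx]; exact hab)
    obtain ⟨y', hy', rfl⟩ := A.exists_cons _ y (by rw [hy]; exact hab)
    exact ⟨x', y', ne_of_apply_ne A.σ hxy, hx', hy'⟩

lemma nontrivial_cylinder (x : A.X) (m : ℕ) : (A.cylinder x m).Nontrivial := by
  obtain ⟨y, y', hne, hy, hy'⟩ := A.exists_ne_apply_zero_eq (x.1 m)
  obtain ⟨z, hz, rfl⟩ := A.exists_mem_cylinder_iterate_eq hy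
  obtain ⟨z', hz', rfl⟩ := A.exists_mem_cylinder_iterate_eq hy'
  exact ⟨z, hz, z', hz', ne_of_apply_ne _ hne⟩

instance : PerfectSpace A.X := by
  refine perfectSpace_iff_forall_not_isolated.2 fun x => nhdsWithin_neBot.2 fun U hU => ?_
  obtain ⟨m, -, hm⟩ := (A.hasBasis_nhds_cylinder x).mem_iff.1 hU
  obtain ⟨y, hy, hyx⟩ := (A.nontrivial_cylinder x m).exists_ne x
  exact ⟨y, hm hy, hyx⟩

lemma isEssentiallyFree_σ : IsEssentiallyFree A.σ := by
  intro p q hpq x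
  wlog hlt : p < q generalizing p q
  · exact (this hpq.symm (by omega)).mono fun _ => Ne.symm
  by_contra hfreq
  have hev : ∀ᶠ y in 𝓝 x, (A.σ)^[p] y = (A.σ)^[q] y := by
    simpa only [not_frequently, not_not] using hfreq
  obtain ⟨y, ⟨hpqy, hy⟩, hyx⟩ :=
    (infinite_of_mem_nhds x (hev.and (A.cylinder_mem_nhds x q))).nontrivial.exists_ne x
  -- The relation `y (n + q) = y (n + p)` determines `y` from its first `q` coordinates.
  have key : ∀ d, y ∈ A.cylinder x (q + d) := by
    intro d
    induction d with
    | zero => exact hy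
    | succ d ih =>
      exact mem_cylinder_of_iterate_eq hpqy.symm hev.self_of_nhds.symm hy
        (cylinder_anti x (by omega) ih)
  exact hyx (eq_of_forall_mem_cylinder fun m => cylinder_anti x (by omega) (key m))

end ConditionI

section PeriodicPoints

lemma exists_bounded_iterate_eq : ∃ R : ℕ, ∀ (a : Fin A.N) (x : A.X),
    ∃ (y : A.X) (r : ℕ), 0 < r ∧ r ≤ R ∧ y.1 0 = a ∧ (A.σ)^[r] y = x := by
  let := Matrix.toQuiver A.mat
  choose path hpath using A.irreducible.connected
  let len : Fin A.N × Fin A.N → ℕ := fun ab => (path ab.1 ab.2).length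
  refine ⟨Finset.univ.sup len, fun a x => ?_⟩
  obtain ⟨y, hy, hyx⟩ := A.exists_path a (x.1 0) (path a (x.1 0)) x rfl
  exact ⟨y, _, hpath _ _, Finset.le_sup (f := len) (Finset.mem_univ (a, x.1 0)), hy, hyx⟩

variable {A} in
lemma exists_isPeriodicPt_mem_cylinder_of_apply_eq {x : A.X} {n : ℕ} (hn : 0 < n)
    (hx : x.1 n = x.1 0) : ∃ p ∈ A.cylinder x n, IsPeriodicPt A.σ n p := by
  have hstep : ∀ i, A.mat (x.1 (i % n)) (x.1 ((i + 1) % n)) = 1 := by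
    intro i
    have hx' : x.1 ((i + 1) % n) = x.1 (i % n + 1) := by
      rw [← Nat.mod_add_mod]
      rcases (Nat.succ_le_of_lt (Nat.mod_lt i hn)).lt_or_eq with hlt | heq
      · rw [Nat.mod_eq_of_lt hlt]
      · rw [show i % n + 1 = n from heq, Nat.mod_self, hx]
    rw [hx']
    exact x.2 _
  refine ⟨⟨fun i => x.1 (i % n), hstep⟩, fun i hi => congrArg x.1 (Nat.mod_eq_of_lt hi), ?_⟩
  refine Subtype.ext (funext fun i => ?_)
  rw [σ_iterate]
  exact congrArg x.1 (Nat.add_mod_right i n)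

lemma exists_isPeriodicPt_mem_cylinder : ∃ R : ℕ, ∀ (x : A.X) (m : ℕ),
    ∃ p ∈ A.cylinder x m, ∃ r, 0 < r ∧ r ≤ R ∧ IsPeriodicPt A.σ (m + r) p := by
  obtain ⟨R, hR⟩ := A.exists_bounded_iterate_eq
  refine ⟨R, fun x m => ?_⟩
  obtain ⟨y, r, hr, hrR, hy, hyx⟩ := hR (x.1 m) x
  obtain ⟨z, hz, hzy⟩ := A.exists_prefix m x y hy
  have hreturn : z.1 (m + r) = z.1 0 := by
    rw [hz 0 m.zero_le, ← hyx, ← hzy, σ_iterate, σ_iterate, zero_add, add_comm]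
  obtain ⟨p, hp, hper⟩ := exists_isPeriodicPt_mem_cylinder_of_apply_eq (by omega) hreturn
  exact ⟨p, fun i hi => (hp i (by omega)).trans (hz i hi.le), r, hr, hrR, hper⟩

end PeriodicPoints

section PrefixDependence

instance : CompactSpace A.X := by
  have hclosed : IsClosed {x : ℕ → Fin A.N | ∀ n, A.mat (x n) (x (n + 1)) = 1} := by
    rw [Set.ofPred_forall]
    exact isClosed_iInter fun n =>
      (isClosed_discrete {ab : Fin A.N × Fin A.N | A.mat ab.1 ab.2 = 1}).preimage
        (f := fun x : ℕ → Fin A.N => (x n, x (n + 1))) (by fun_prop)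
  exact isCompact_iff_compactSpace.1 hclosed.isCompact

variable {A} {Y : Type*}

/-- `F` depends only on the first `m` coordinates; for some `m` this holds as soon as `F` is
continuous with values in a discrete space. -/
def DependsOnPrefix (F : A.X → Y) (m : ℕ) : Prop :=
  ∀ ⦃x y : A.X⦄, y ∈ A.cylinder x m → F y = F x

lemma exists_dependsOnPrefix [TopologicalSpace Y] [DiscreteTopology Y] {F : A.X → Y}
    (hF : Continuous F) : ∃ m, DependsOnPrefix F m := by
  have hloc : ∀ x, ∃ m, ∀ y ∈ A.cylinder x m, F y = F x := fun x => by
    simpa using (A.hasBasis_nhds_cylinder x).eventually_iff.1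
      (((IsLocallyConstant.iff_continuous F).2 hF).eventually_eq x)
  choose m hm using hloc
  obtain ⟨t, ht⟩ := CompactSpace.elim_nhds_subcover (fun x => A.cylinder x (m x))
    (fun x => A.cylinder_mem_nhds x (m x))
  refine ⟨t.sup m, fun x y hxy => ?_⟩
  obtain ⟨z, hz, hxz⟩ : ∃ z ∈ t, x ∈ A.cylinder z (m z) := by
    simpa using ht.ge (Set.mem_univ x)
  have hyz : y ∈ A.cylinder z (m z) := fun i hi =>
    (hxy i (hi.trans_le (Finset.le_sup hz))).trans (hxz i hi)
  rw [hm z y hyz, hm z x hxz]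

lemma DependsOnPrefix.continuous [TopologicalSpace Y] {F : A.X → Y} {m : ℕ}
    (hF : DependsOnPrefix F m) : Continuous F :=
  IsLocallyConstant.continuous <| (IsLocallyConstant.iff_eventually_eq F).2 fun x =>
    mem_of_superset (A.cylinder_mem_nhds x m) fun _ hy => hF hy

lemma DependsOnPrefix.birkhoffSum_eq [AddCommMonoid Y] {F : A.X → Y} {m n : ℕ}
    (hF : DependsOnPrefix F m) {x y : A.X} (hxy : y ∈ A.cylinder x (n + m)) :
    birkhoffSum A.σ F n y = birkhoffSum A.σ F n x := by
  refine Finset.sum_congr rfl fun i hi => hF (mem_cylinder_add_iff.1 ?_).2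
  have := Finset.mem_range.1 hi
  exact cylinder_anti x (by omega) hxy

end PrefixDependence

end MarkovShift

section NonnegativePeriodicSums

open Function

/-- The sums `F y + F (T y) + ⋯ + F (T^[n - 1] y)` over all orbit segments that end just before
`x = T^[n] y`. Their infimum is the transfer function that makes `F` nonnegative. -/
def pastSums {X G : Type*} [AddCommMonoid G] (T : X → X) (F : X → G) (x : X) : Set G :=
  {a | ∃ n y, T^[n] y = x ∧ birkhoffSum T F n y = a}

lemma sInf_pastSums_apply_le {X G : Type*} [AddCommGroup G] [ConditionallyCompleteLattice G]
    [IsOrderedAddMonoid G] {T : X → X} {F : X → G} {c : G}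
    (hc : ∀ n x, c ≤ birkhoffSum T F n x) (x : X) :
    sInf (pastSums T F (T x)) ≤ sInf (pastSums T F x) + F x := by
  rw [← sub_le_iff_le_add]
  refine le_csInf ⟨_, 0, x, rfl, rfl⟩ ?_
  rintro _ ⟨n, y, rfl, rfl⟩
  rw [sub_le_iff_le_add, ← birkhoffSum_succ]
  refine csInf_le ⟨c, ?_⟩ ⟨n + 1, y, iterate_succ_apply' _ _ _, rfl⟩
  rintro _ ⟨k, z, -, rfl⟩
  exact hc k z

namespace MarkovShift

variable {A : MarkovShift}

lemma DependsOnPrefix.pastSums_subset {G : Type*} [AddCommMonoid G] {F : A.X → G} {m : ℕ}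
    (hF : DependsOnPrefix F m) {x x' : A.X} (hx : x' ∈ A.cylinder x (m + 1)) :
    pastSums A.σ F x ⊆ pastSums A.σ F x' := by
  rintro _ ⟨n, y, rfl, rfl⟩
  have hglue : x'.1 0 = y.1 n := by
    rw [hx 0 m.succ_pos, σ_iterate, zero_add]
  obtain ⟨z, hz, rfl⟩ := A.exists_mem_cylinder_iterate_eq hglue
  exact ⟨n, z, rfl, hF.birkhoffSum_eq
    (mem_cylinder_add_iff.2 ⟨hz, cylinder_anti _ m.le_succ hx⟩)⟩

lemma DependsOnPrefix.sInf_pastSums {G : Type*} [AddCommMonoid G] [InfSet G] {F : A.X → G}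
    {m : ℕ} (hF : DependsOnPrefix F m) :
    DependsOnPrefix (fun x => sInf (pastSums A.σ F x)) (m + 1) := fun _ _ hxy =>
  congrArg sInf ((hF.pastSums_subset (mem_cylinder_comm.1 hxy)).antisymm (hF.pastSums_subset hxy))

lemma exists_le_birkhoffSum {F : C(A.X, ℤ)}
    (hper : ∀ x n, 0 < n → IsPeriodicPt A.σ n x → 0 ≤ birkhoffSum A.σ F n x) :
    ∃ c, ∀ n x, c ≤ birkhoffSum A.σ F n x := by
  obtain ⟨m, hm⟩ := exists_dependsOnPrefix F.continuous
  obtain ⟨R, hR⟩ := A.exists_isPeriodicPt_mem_cylinder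
  obtain ⟨b, hb⟩ := (isCompact_range F.continuous).bddAbove
  have hFb : ∀ x, F x ≤ |b| := fun x => (hb ⟨x, rfl⟩).trans (le_abs_self b)
  refine ⟨-((m + R : ℕ) * |b|), fun n x => ?_⟩
  obtain ⟨p, hpx, r, hr, hrR, hp⟩ := hR x (n + m)
  have hperiod : 0 ≤ birkhoffSum A.σ F n x + birkhoffSum A.σ F (m + r) ((A.σ)^[n] p) := by
    rw [← hm.birkhoffSum_eq hpx, ← birkhoffSum_add, ← add_assoc]
    exact hper p _ (by omega) hp
  have htail : birkhoffSum A.σ F (m + r) ((A.σ)^[n] p) ≤ (m + R : ℕ) * |b| :=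
    calc birkhoffSum A.σ F (m + r) ((A.σ)^[n] p) ≤ (m + r : ℕ) * |b| := by
          exact (Finset.sum_le_card_nsmul _ _ |b| fun i _ => hFb _).trans_eq (by simp)
      _ ≤ (m + R : ℕ) * |b| := by gcongr
  linarith

lemma exists_nonneg_add_coboundary {F : C(A.X, ℤ)}
    (hper : ∀ x n, 0 < n → IsPeriodicPt A.σ n x → 0 ≤ birkhoffSum A.σ F n x) :
    ∃ ξ : C(A.X, ℤ), 0 ≤ F + coboundary A ξ := by
  obtain ⟨c, hc⟩ := exists_le_birkhoffSum hper
  obtain ⟨m, hm⟩ := exists_dependsOnPrefix F.continuous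
  refine ⟨⟨_, hm.sInf_pastSums.continuous⟩, fun x => ?_⟩
  change 0 ≤ F x + (sInf (pastSums A.σ F x) - sInf (pastSums A.σ F (A.σ x)))
  linarith [sInf_pastSums_apply_le hc x]

end MarkovShift

end NonnegativePeriodicSums

section LocalOrbitRelation

open Filter Topology Function

variable {A B C : MarkovShift}

lemma OrbitEq.eventually_iterate {h : A.X → B.X} {k l : C(A.X, ℕ)} (hkl : OrbitEq h k l) (n : ℕ)
    (x : A.X) : ∀ᶠ y in 𝓝 x,
      (B.σ)^[birkhoff k n x] (h ((A.σ)^[n] y)) = (B.σ)^[birkhoff l n x] (h y) := by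
  have hconst : ∀ j : C(A.X, ℕ), ∀ᶠ y in 𝓝 x, birkhoff j n y = birkhoff j n x := fun j =>
    ((IsLocallyConstant.iff_continuous _).2 (continuous_birkhoff j n)).eventually_eq x
  filter_upwards [hconst k, hconst l] with y hk hl
  rw [← hk, ← hl]
  exact hkl.iterate n y

lemma OrbitEq.eventually {h : A.X → B.X} {k l : C(A.X, ℕ)} (hkl : OrbitEq h k l) (x : A.X) :
    ∀ᶠ y in 𝓝 x, (B.σ)^[k x] (h (A.σ y)) = (B.σ)^[l x] (h y) := by
  simpa [birkhoff] using hkl.eventually_iterate 1 x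

lemma lag_pos_of_isPeriodicPt {h : A.X → B.X} (hh : IsLocalHomeomorph h) {x : A.X} {n K L : ℕ}
    (hn : 0 < n) (hx : IsPeriodicPt A.σ n x)
    (hKL : ∀ᶠ y in 𝓝 x, (B.σ)^[K] (h ((A.σ)^[n] y)) = (B.σ)^[L] (h y)) : K < L := by
  by_contra! hLK
  have hσ : ContinuousAt (A.σ)^[n] x := (A.σ.continuous.iterate n).continuousAt
  have hhx : (B.σ)^[K] (h x) = (B.σ)^[L] (h x) := by
    simpa only [hx.eq] using hKL.self_of_nhds
  have hcyl : ∀ᶠ y in 𝓝 x, h ((A.σ)^[n] y) ∈ B.cylinder (h x) K :=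
    (hh.continuous.continuousAt.comp hσ).eventually_mem
      (by simpa only [comp_apply, hx.eq] using B.cylinder_mem_nhds (h x) K)
  have hstable : ∀ᶠ y in 𝓝 x, ∀ N, True → h y ∈ B.cylinder (h x) N →
      h ((A.σ)^[n] y) ∈ B.cylinder (h x) N := by
    filter_upwards [hcyl, hKL] with y hyK hy N _ hyN
    rcases le_total N K with hNK | hKN
    · exact MarkovShift.cylinder_anti _ hNK hyK
    · obtain ⟨d, rfl⟩ := Nat.exists_eq_add_of_le hKN
      exact MarkovShift.mem_cylinder_of_iterate_eq hy hhx hyK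
        (MarkovShift.cylinder_anti _ (by omega) hyN)
  obtain ⟨W, hW, hWn, hmaps⟩ := exists_nhds_mapsTo_of_isLocalHomeomorph hh hσ hx
    (B.hasBasis_nhds_cylinder (h x)) hstable (A.cylinder_mem_nhds x n)
  obtain ⟨y, hy, hyx⟩ := (infinite_of_mem_nhds x hW).nontrivial.exists_ne x
  exact hyx (MarkovShift.eq_of_forall_iterate_mem_cylinder hn hx
    fun r => hWn (hmaps.iterate r hy))

end LocalOrbitRelation

section PsiProperties

open Filter Topology Function

variable {A B C : MarkovShift}

lemma Psi_apply (h : ContOrbitMap A B) (f : C(B.X, ℤ)) (x : A.X) :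
    Psi h f x = birkhoffSum B.σ f (h.l x) (h.toFun x) -
      birkhoffSum B.σ f (h.k x) (h.toFun (A.σ x)) := rfl

lemma Psi_apply_eq_of_eventually (h : ContOrbitMap A B) (f : C(B.X, ℤ)) {x : A.X} {a b : ℕ}
    (hab : ∀ᶠ y in 𝓝 x, (B.σ)^[a] (h.toFun (A.σ y)) = (B.σ)^[b] (h.toFun y)) :
    Psi h f x = birkhoffSum B.σ f b (h.toFun x) - birkhoffSum B.σ f a (h.toFun (A.σ x)) :=
  birkhoffSum_sub_eq_of_lag_eq (h.orbitEq x) hab.self_of_nhds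
    (B.isEssentiallyFree_σ.lag_eq h.isContOrbitMap.1.isOpenMap (h.orbitEq.eventually x) hab)

lemma Psi_apply_eq_cocycleSum (h : ContOrbitMap A B) {k l : C(A.X, ℕ)}
    (hkl : OrbitEq h.toFun k l) (f : C(B.X, ℤ)) (x : A.X) :
    Psi h f x = cocycleSum h.toFun k l f x :=
  Psi_apply_eq_of_eventually h f (hkl.eventually x)

lemma birkhoffSum_Psi (h : ContOrbitMap A B) (f : C(B.X, ℤ)) (n : ℕ) (x : A.X) :
    birkhoffSum A.σ (Psi h f) n x =
      birkhoffSum B.σ f (birkhoff h.l n x) (h.toFun x) -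
        birkhoffSum B.σ f (birkhoff h.k n x) (h.toFun ((A.σ)^[n] x)) := by
  induction n with
  | zero => simp [birkhoff]
  | succ n ih =>
    have birkhoff_succ : ∀ j : C(A.X, ℕ),
        birkhoff j (n + 1) x = birkhoff j n x + j ((A.σ)^[n] x) :=
      fun j => birkhoffSum_succ A.σ j n x
    rw [birkhoffSum_succ, ih, Psi_apply, birkhoff_succ, birkhoff_succ, iterate_succ_apply',
      ← birkhoffSum_sub_sub_of_iterate_eq (h.orbitEq.iterate n x).symm (h.orbitEq _)]
    abel

lemma Psi_Psi (h : ContOrbitMap A B) (g : ContOrbitMap B C) (f : C(C.X, ℤ)) :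
    Psi h (Psi g f) = Psi (g.comp h) f := by
  ext x
  have hl := g.orbitEq.eventually_iterate (h.l x) (h.toFun x)
  have hk := g.orbitEq.eventually_iterate (h.k x) (h.toFun (A.σ x))
  have hgh : ∀ᶠ y in 𝓝 x,
      (C.σ)^[birkhoff g.k (h.l x) (h.toFun x) + birkhoff g.l (h.k x) (h.toFun (A.σ x))]
        ((g.comp h).toFun (A.σ y)) =
      (C.σ)^[birkhoff g.l (h.l x) (h.toFun x) + birkhoff g.k (h.k x) (h.toFun (A.σ x))]
        ((g.comp h).toFun y) := by
    filter_upwards [h.continuous.continuousAt.eventually hl,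
      (h.continuous.comp A.σ.continuous).continuousAt.eventually hk, h.orbitEq.eventually x]
      with y hly hky hy
    rw [comp_apply, hy] at hky
    exact (iterate_add_eq_of_iterate_eq hly.symm hky.symm).symm
  rw [Psi_apply_eq_of_eventually _ f hgh, Psi_apply, birkhoffSum_Psi, birkhoffSum_Psi,
    h.orbitEq x]
  refine birkhoffSum_sub_sub_of_iterate_eq hl.self_of_nhds.symm ?_
  rw [← h.orbitEq x]
  exact hk.self_of_nhds.symm

lemma Psi_id (f : C(A.X, ℤ)) : Psi (ContOrbitMap.id A) f = f := by
  ext x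
  have hshift : ∀ᶠ y in 𝓝 x, (A.σ)^[0] ((ContOrbitMap.id A).toFun (A.σ y)) =
      (A.σ)^[1] ((ContOrbitMap.id A).toFun y) := .of_forall fun _ => rfl
  rw [Psi_apply_eq_of_eventually _ f hshift]
  simp [ContOrbitMap.id]

lemma birkhoffSum_Psi_nonneg (h : ContOrbitMap A B) {f : C(B.X, ℤ)} (hf : 0 ≤ f) {x : A.X}
    {n : ℕ} (hn : 0 < n) (hx : IsPeriodicPt A.σ n x) : 0 ≤ birkhoffSum A.σ (Psi h f) n x := by
  have hlag : birkhoff h.k n x < birkhoff h.l n x :=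
    lag_pos_of_isPeriodicPt h.isContOrbitMap.1 hn hx (h.orbitEq.eventually_iterate n x)
  obtain ⟨d, hd⟩ := Nat.exists_eq_add_of_le hlag.le
  rw [birkhoffSum_Psi, hx.eq, hd, birkhoffSum_add, add_sub_cancel_left]
  exact Finset.sum_nonneg fun i _ => hf _

lemma PsiBar_mk (h : ContOrbitMap A B) (f : C(B.X, ℤ)) :
    PsiBar h (H.mk B f) = H.mk A (Psi h f) := rfl

lemma PsiBar_PsiBar (h : ContOrbitMap A B) (g : ContOrbitMap B C) (u : H C) :
    PsiBar h (PsiBar g u) = PsiBar (g.comp h) u := by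
  obtain ⟨f, rfl⟩ := QuotientAddGroup.mk'_surjective _ u
  rw [PsiBar_mk, PsiBar_mk, PsiBar_mk, Psi_Psi]

lemma PsiBar_id (u : H A) : PsiBar (ContOrbitMap.id A) u = u := by
  obtain ⟨f, rfl⟩ := QuotientAddGroup.mk'_surjective _ u
  rw [PsiBar_mk, Psi_id]

lemma psiBarPositive : PsiBarPositive := by
  rintro A B h _ ⟨f, hf, rfl⟩
  obtain ⟨ξ, hξ⟩ := MarkovShift.exists_nonneg_add_coboundary
    fun _ _ hn hx => birkhoffSum_Psi_nonneg h hf hn hx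
  have hcobdy : H.mk A (coboundary A ξ) = 0 := (QuotientAddGroup.eq_zero_iff _).2 ⟨ξ, rfl⟩
  exact ⟨_, hξ, by rw [map_add, hcobdy, add_zero, PsiBar_mk]⟩

end PsiProperties

section Functors

/-- The contravariant functor `(X_A, σ_A) ↦ (H^A, H^A_+)`, `h ↦ Ψ̄_h`. -/
noncomputable def psiFunctor : MarkovShiftᵒᵖ ⥤ OrdAb where
  __ := psiCorrespondence psiBarPositive
  map_id _ := OrdAb.Hom.ext (AddMonoidHom.ext PsiBar_id)
  map_comp h g := OrdAb.Hom.ext (AddMonoidHom.ext fun u => (PsiBar_PsiBar g.unop h.unop u).symm)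

/-- The functor sending a continuous orbit equivalence class to its chosen representative; it is
the identity on morphisms, since these are defined as maps between the representatives. -/
noncomputable def COEClass.repFunctor : COEClass ⥤ MarkovShift where
  obj := COEClass.rep
  map h := h

variable {A B : MarkovShift}

/-- A continuous orbit homeomorphism as an isomorphism in the category of Markov shifts. -/
def ContOrbitMap.isoOfHomeomorph (e : A.X ≃ₜ B.X) (he : IsContOrbitMap e)
    (he' : IsContOrbitMap e.symm) : A ≅ B where
  hom := ⟨e, he⟩
  inv := ⟨e.symm, he'⟩
  hom_inv_id := ContOrbitMap.ext (funext e.symm_apply_apply)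
  inv_hom_id := ContOrbitMap.ext (funext e.apply_symm_apply)

lemma ContOrbitEquiv.nonempty_iso : ContOrbitEquiv A B → Nonempty (A ≅ B) :=
  fun ⟨e, he, he'⟩ => ⟨ContOrbitMap.isoOfHomeomorph e he he'⟩

lemma COEClass.contOrbitEquiv_rep_mk (A : MarkovShift) : ContOrbitEquiv A (COEClass.mk A).rep :=
  contOrbitEquiv_equivalence.symm (Quotient.exact (Quotient.out_eq (COEClass.mk A)))

end Functors

theorem theorem3 :
    (∀ (A B C : MarkovShift) (h : ContOrbitMap A B) (g : ContOrbitMap B C),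
      -- `Ψ_h` does not depend on the choice of the functions `k`, `l`
      (∀ k l : C(A.X, ℕ), OrbitEq h.toFun k l →
        ∀ (f : C(B.X, ℤ)) (x : A.X), Psi h f x = cocycleSum h.toFun k l f x) ∧
      -- (i)
      (∀ f : C(C.X, ℤ), Psi h (Psi g f) = Psi (g.comp h) f) ∧
      -- (ii)
      (cobdy B).map (Psi h) ≤ cobdy A ∧ (cobdy C).map (Psi g) ≤ cobdy B ∧
      -- (iii)
      (∀ u ∈ HPlus B, PsiBar h u ∈ HPlus A) ∧ (∀ u ∈ HPlus C, PsiBar g u ∈ HPlus B) ∧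
      (∀ u : H C, PsiBar h (PsiBar g u) = PsiBar (g.comp h) u)) ∧
    ∃ hpos : PsiBarPositive,
      -- contravariant functor on Markov shifts
      (∃ F : MarkovShiftᵒᵖ ⥤ OrdAb, F.toPrefunctor = psiCorrespondence hpos) ∧
      -- continuous orbit homeomorphisms induce isomorphisms of ordered groups
      (∀ (A B : MarkovShift) (e : A.X ≃ₜ B.X) (he : IsContOrbitMap e)
        (he' : IsContOrbitMap e.symm), ∃ i : orderedH B ≅ orderedH A,
          i.hom = psiHom hpos ⟨e, he⟩ ∧ i.inv = psiHom hpos ⟨e.symm, he'⟩) ∧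
      -- contravariant functor on continuous orbit equivalence classes
      (∃ F : COEClassᵒᵖ ⥤ OrdAb, F.toPrefunctor = psiClassCorrespondence hpos ∧
        ∀ A : MarkovShift, Nonempty (F.obj (Opposite.op (COEClass.mk A)) ≅ orderedH A)) := by
  refine ⟨fun A B C h g => ⟨fun k l hkl => Psi_apply_eq_cocycleSum h hkl, Psi_Psi h g,
    AddSubgroup.map_le_iff_le_comap.2 (cobdy_le_comap_Psi h),
    AddSubgroup.map_le_iff_le_comap.2 (cobdy_le_comap_Psi g),
    psiBarPositive h, psiBarPositive g, PsiBar_PsiBar h g⟩,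
    psiBarPositive, ⟨psiFunctor, rfl⟩, fun A B e he he' => ?_,
    COEClass.repFunctor.op ⋙ psiFunctor, rfl, fun A => ?_⟩
  · exact ⟨psiFunctor.mapIso (ContOrbitMap.isoOfHomeomorph e he he').op, rfl, rfl⟩
  · exact (COEClass.contOrbitEquiv_rep_mk A).nonempty_iso.map fun i => psiFunctor.mapIso i.op
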